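/- For $n\ge 1$ let $R_n$ be the linear hexagonal cylinder chain: its $4n$ vertices are $p_i,u_i,q_i,v_i$ with indices read modulo $n$ (so $p_0=p_n$, $q_0=q_n$, $u_0=u_n$, $v_0=v_n$), and its $5n$ edges are $p_iu_i,\ u_ip_{i+1},\ q_iv_i,\ v_iq_{i+1},\ p_iq_i$ for $i=1,\dots,n$. Thus its $i$-th hexagon is $p_{i-1},u_{i-1},p_i,q_i,v_{i-1},q_{i-1}$. (For $n\ge2$ this is a simple graph; for $n=1$ it is a multigraph in which $p_1u_1$ and $q_1v_1$ are double edges.) Let $r(x,y)$ denote the resistance distance in $R_n$, i.e. the potential difference between $x$ and $y$ when every edge is a unit resistor and a unit current enters at $x$ and leaves at $y$. Put $\alpha=3-2\sqrt2$. Then for all $1\le i\le n$, $$r(p_1,p_i)=\frac{1+\alpha^{n}-\alpha^{n-i+1}-\alpha^{i-1}}{2\sqrt{2}(1-\alpha^{n})}+\frac{(n-i+1)(i-1)}{n},$$ $$r(p_1,q_i)=\frac{1+\alpha^{n}+\alpha^{n-i+1}+\alpha^{i-1}}{2\sqrt{2}(1-\alpha^{n})}+\frac{(n-i+1)(i-1)}{n},$$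 $$r(u_1,u_i)=\frac{1+\alpha^{n}-\alpha^{n-i+1}-\alpha^{i-1}}{\sqrt{2}(1-\alpha^{n})}+\frac{(n-i+1)(i-1)}{n},$$ $$r(u_1,v_i)=\frac{1+\alpha^{n}+\alpha^{n-i+1}+\alpha^{i-1}}{\sqrt{2}(1-\alpha^{n})}+\frac{(n-i+1)(i-1)}{n},$$ $$r(p_1,u_i)=\frac{11+2\sqrt{2}-(20+14\sqrt{2})\alpha^{i+1}-(20-14\sqrt{2})\alpha^{n-i-1}-(5+2\sqrt{2})\alpha^{n}}{4\sqrt{2}(1-\alpha^{n})}-\frac{(2i-1)^{2}}{4n}+i-1-\sqrt{2},$$ $$r(p_1,v_i)=\frac{11+2\sqrt{2}+(20+14\sqrt{2})\alpha^{i+1}+(20-14\sqrt{2})\alpha^{n-i-1}-(5+2\sqrt{2})\alpha^{n}}{4\sqrt{2}(1-\alpha^{n})}-\frac{(2i-1)^{2}}{4n}+i-1-\sqrt{2}.$$ Moreover these formulae determine all pairwise resistances: $r$ is symmetric, and for all $k,j,i\in\{1,\dots,n\}$ with $i\equiv j-k+1\pmod n$, $$\begin{array}{ll} r(p_k,p_j)=r(q_k,q_j)=r(p_1,p_i),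 & r(p_k,q_j)=r(q_k,p_j)=r(p_1,q_i),\\ r(p_k,u_j)=r(q_k,v_j)=r(p_1,u_i), & r(p_k,v_j)=r(q_k,u_j)=r(p_1,v_i),\\ r(u_k,u_j)=r(v_k,v_j)=r(u_1,u_i), & r(u_k,v_j)=r(v_k,u_j)=r(u_1,v_i). \end{array}$$ -/

import Mathlib

namespace Graph

open Classical in
/-- The net current that flows out of the vertex `x` when every edge of the finite multigraph `G`
is a resistor of unit resistance and the vertices are held at the potentials `φ`. In other words
this is `(L φ) x`, where `L` is the discrete Laplacian of `G`. (For an edge `e` incident with `x`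
there is exactly one `y` with `G.IsLink e x y`, namely the other end of `e`;
parallel edges are counted with multiplicity.) -/
noncomputable def netCurrent {α β : Type*} [Fintype α] [Fintype β] (G : Graph α β)
    (φ : α → ℝ) (x : α) : ℝ :=
  ∑ e : β, ∑ y : α, if G.IsLink e x y then φ x - φ y else 0

open Classical in
/-- `φ` is the potential of a unit current that enters the network at `a` and leaves it at `b`:
Kirchhoff's current law holds at every vertex, with a unit source at `a` and a unit sink at `b`
(which cancel when `a = b`). -/
def IsUnitCurrentPotential {α β : Type*} [Fintype α] [Fintype β] (G : Graph α β)
    (a b : α) (φ : α → ℝ) : Prop :=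
  ∀ x : α, G.netCurrent φ x = (if x = a then 1 else 0) - (if x = b then 1 else 0)

open Classical in
/-- The effective resistance (resistance distance) between `a` and `b`: the potential difference
between `a` and `b` when a unit current enters at `a` and leaves at `b`.
The value does not depend on the chosen potential (`effectiveResistance_eq`); such a potential
exists whenever `a` and `b` lie in the same component, and otherwise the junk value is `0`. -/
noncomputable def effectiveResistance {α β : Type*} [Fintype α] [Fintype β] (G : Graph α β)
    (a b : α) : ℝ :=
  if h : ∃ φ : α → ℝ, G.IsUnitCurrentPotential a b φ then h.choose a - h.choose b else 0

theorem sum_mul_netCurrent_comm {α β : Type*} [Fintype α] [Fintype β] (G : Graph α β)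
    (φ ψ : α → ℝ) :
    ∑ x, ψ x * G.netCurrent φ x = ∑ x, φ x * G.netCurrent ψ x := by
  classical
  have key : ∀ e : β,
      ∑ x, ∑ y, (if G.IsLink e x y then ψ x * (φ x - φ y) else 0) =
        ∑ x, ∑ y, (if G.IsLink e x y then φ x * (ψ x - ψ y) else 0) := by
    intro e
    have h1 : ∑ x, ∑ y, (if G.IsLink e x y then ψ x * φ y else 0) =
        ∑ x, ∑ y, (if G.IsLink e x y then φ x * ψ y else 0) := by
      rw [Finset.sum_comm]
      refine Finset.sum_congr rfl fun x _ => Finset.sum_congr rfl fun y _ => ?_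
      simp only [G.isLink_comm (x := y) (y := x), mul_comm]
    rw [← sub_eq_zero] at h1 ⊢
    simp only [← Finset.sum_sub_distrib] at h1 ⊢
    rw [← neg_eq_zero, ← h1]
    simp only [← Finset.sum_neg_distrib]
    refine Finset.sum_congr rfl fun x _ => Finset.sum_congr rfl fun y _ => ?_
    split_ifs <;> ring
  simp only [netCurrent, Finset.mul_sum, mul_ite, mul_zero]
  rw [Finset.sum_comm, Finset.sum_comm (s := Finset.univ (α := α)) (t := Finset.univ (α := β))]
  exact Finset.sum_congr rfl fun e _ => key e

/-- The effective resistance is the potential difference for every unit-current potential. -/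
theorem effectiveResistance_eq {α β : Type*} [Fintype α] [Fintype β] (G : Graph α β)
    {a b : α} {φ : α → ℝ} (hφ : G.IsUnitCurrentPotential a b φ) :
    G.effectiveResistance a b = φ a - φ b := by
  classical
  have h : ∃ φ : α → ℝ, G.IsUnitCurrentPotential a b φ := ⟨φ, hφ⟩
  rw [effectiveResistance, dif_pos h]
  have hc := h.choose_spec
  have := G.sum_mul_netCurrent_comm φ h.choose
  simp only [hφ _, hc _] at this
  simpa [mul_sub, Finset.sum_sub_distrib] using this

end Graph

namespace HexCylinder

/-- The four kinds of vertices `p, u, q, v`. -/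
inductive Site
  | p | u | q | v
  deriving DecidableEq

instance : Fintype Site where
  elems := {Site.p, Site.u, Site.q, Site.v}
  complete x := by cases x <;> decide

/-- The five kinds of edges: `p_i u_i`, `u_i p_{i+1}`, `q_i v_i`, `v_i q_{i+1}` and `p_i q_i`. -/
inductive Bond
  | pu | up | qv | vq | pq
  deriving DecidableEq

instance : Fintype Bond where
  elems := {Bond.pu, Bond.up, Bond.qv, Bond.vq, Bond.pq}
  complete x := by cases x <;> decide

/-- The `4 n` vertices; indices are read modulo `n`, so that `p_0 = p_n` and so on. -/
abbrev Vertex (n : ℕ) : Type := Site × ZMod n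

/-- The `5 n` edges. -/
abbrev Edge (n : ℕ) : Type := Bond × ZMod n

/-- The vertex `p_i`. -/
def p {n : ℕ} (i : ZMod n) : Vertex n := (Site.p, i)

/-- The vertex `u_i`, which lies between `p_i` and `p_{i+1}`. -/
def u {n : ℕ} (i : ZMod n) : Vertex n := (Site.u, i)

/-- The vertex `q_i`. -/
def q {n : ℕ} (i : ZMod n) : Vertex n := (Site.q, i)

/-- The vertex `v_i`, which lies between `q_i` and `q_{i+1}`. -/
def v {n : ℕ} (i : ZMod n) : Vertex n := (Site.v, i)

/-- The unordered pair of ends of an edge. -/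
def ends {n : ℕ} : Edge n → Sym2 (Vertex n)
  | (Bond.pu, i) => s(p i, u i)
  | (Bond.up, i) => s(u i, p (i + 1))
  | (Bond.qv, i) => s(q i, v i)
  | (Bond.vq, i) => s(v i, q (i + 1))
  | (Bond.pq, i) => s(p i, q i)

/-- The hexagonal cylinder chain `R_n`: its `i`-th hexagon is
`p_{i-1}, u_{i-1}, p_i, q_i, v_{i-1}, q_{i-1}`, with all indices modulo `n`.
It is a simple graph for `n ≥ 2`; for `n = 1` the edges `p_1 u_1` and `q_1 v_1` are doubled. -/
def chain (n : ℕ) : Graph (Vertex n) (Edge n) where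
  vertexSet := Set.univ
  IsLink e x y := ends e = s(x, y)
  edgeSet := Set.univ
  isLink_symm e _ := ⟨fun x y h => h.trans Sym2.eq_swap⟩
  eq_or_eq_of_isLink_of_isLink e x y z w h h' := by
    rcases Sym2.eq_iff.1 (h.symm.trans h') with ⟨h, -⟩ | ⟨h, -⟩
    · exact Or.inl h
    · exact Or.inr h
  edge_mem_iff_exists_isLink e := by
    refine ⟨fun _ => ?_, fun _ => Set.mem_univ e⟩
    induction h : ends e using Sym2.ind with
    | _ x y => exact ⟨x, y, rfl⟩
  left_mem_of_isLink _ x _ _ := Set.mem_univ x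

/-- The effective resistance between two vertices of `R_n`. -/
noncomputable def r {n : ℕ} [NeZero n] (x y : Vertex n) : ℝ :=
  (chain n).effectiveResistance x y

/-- The constant `α = 3 - 2√2`. -/
noncomputable def α : ℝ := 3 - 2 * √2

end HexCylinder

/-!
The resistance distance is read off from a Green function of the network: a function `g a` for each
vertex `a` whose net current is a unit source at `a`, compensated by a drain of `1 / (4 n)` at every
vertex. Then `g a - g b` is a unit-current potential for the pair `a, b`, so that
`r a b = g a a - g a b - g b a + g b b` (`r_eq_green`).

The reflection exchanging `p, u` with `q, v` splits the Laplacian into an even and an odd part.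
Eliminating the vertices `u` and `v`, which have degree two, leaves one difference equation on
`ZMod n` for each part. The even part is a Laplacian on a cycle, solved by a quadratic polynomial of
the index (`evenGreen_laplacian`). The odd part satisfies `6 f j - f (j + 1) - f (j - 1) = δ j`; the
roots of `x ^ 2 - 6 x + 1` are `α` and `α⁻¹`, so it is solved by a combination of powers of `α`
(`oddGreen_laplacian`). The values at `u` and `v` are recovered by averaging. The Green function
depends on the two indices only through their difference and is invariant under the reflection,
hence so is the resistance.
-/

namespace Graph

/-- An edge with ends `a` and `b` contributes to the net current only at `a` and at `b`. -/
theorem sum_ite_ends_eq {V : Type*} [Fintype V] [DecidableEq V] (a b : V) (φ : V → ℝ) (x : V)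
    [∀ y, Decidable (s(a, b) = s(x, y))] :
    (∑ y : V, if s(a, b) = s(x, y) then φ x - φ y else 0) =
      (if x = a then φ a - φ b else 0) + (if x = b then φ b - φ a else 0) := by
  have h : ∀ y : V, (if s(a, b) = s(x, y) then φ x - φ y else 0) =
      (if b = y then (if x = a then φ a - φ b else 0) else 0) +
        (if a = y then (if x = b then φ b - φ a else 0) else 0) := by
    intro y
    by_cases h1 : a = x <;> by_cases h2 : b = x <;> by_cases h3 : b = y <;> by_cases h4 : a = y <;>
      simp_all [eq_comm]
  simp only [h, Finset.sum_add_distrib, Finset.sum_ite_eq, Finset.mem_univ, if_true]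

open Classical in
theorem netCurrent_sub {V W : Type*} [Fintype V] [Fintype W] (G : Graph V W) (φ ψ : V → ℝ) (x : V) :
    G.netCurrent (φ - ψ) x = G.netCurrent φ x - G.netCurrent ψ x := by
  simp only [netCurrent, ← Finset.sum_sub_distrib, Pi.sub_apply]
  refine Finset.sum_congr rfl fun e _ => Finset.sum_congr rfl fun y _ => ?_
  split_ifs <;> ring

end Graph

namespace HexCylinder

/-! ### The Laplacian of the chain -/

theorem netCurrent_chain {n : ℕ} [NeZero n] (φ : Vertex n → ℝ) (x : Vertex n) :
    (chain n).netCurrent φ x =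
      ∑ i : ZMod n,
        (((if x = p i then φ (p i) - φ (u i) else 0) +
            (if x = u i then φ (u i) - φ (p i) else 0)) +
          ((if x = u i then φ (u i) - φ (p (i + 1)) else 0) +
            (if x = p (i + 1) then φ (p (i + 1)) - φ (u i) else 0)) +
          ((if x = q i then φ (q i) - φ (v i) else 0) +
            (if x = v i then φ (v i) - φ (q i) else 0)) +
          ((if x = v i then φ (v i) - φ (q (i + 1)) else 0) +
            (if x = q (i + 1) then φ (q (i + 1)) - φ (v i) else 0)) +
          ((if x = p i then φ (p i) - φ (q i) else 0) +
            (if x = q i then φ (q i) - φ (p i) else 0))) := by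
  have hB : (Finset.univ : Finset Bond) = {Bond.pu, Bond.up, Bond.qv, Bond.vq, Bond.pq} := rfl
  classical
  have key : ∀ (e : Edge n) (a b : Vertex n), ends e = s(a, b) →
      (∑ y, if (chain n).IsLink e x y then φ x - φ y else 0) =
        (if x = a then φ a - φ b else 0) + (if x = b then φ b - φ a else 0) := by
    intro e a b h
    rw [← Graph.sum_ite_ends_eq]
    simp only [chain, h]
  unfold Graph.netCurrent
  rw [Fintype.sum_prod_type, hB]
  rw [Finset.sum_insert (by decide), Finset.sum_insert (by decide), Finset.sum_insert (by decide),
    Finset.sum_insert (by decide), Finset.sum_singleton]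
  simp only [fun i => key (Bond.pu, i) (p i) (u i) rfl,
    fun i => key (Bond.up, i) (u i) (p (i + 1)) rfl, fun i => key (Bond.qv, i) (q i) (v i) rfl,
    fun i => key (Bond.vq, i) (v i) (q (i + 1)) rfl, fun i => key (Bond.pq, i) (p i) (q i) rfl,
    Finset.sum_add_distrib]
  ring

/-- Reindexing by the shift `i ↦ i + 1` of the cycle. -/
theorem sum_ite_eq_add_one {n : ℕ} [NeZero n] (j : ZMod n) (f : ZMod n → ℝ) :
    (∑ i : ZMod n, if j = i + 1 then f i else 0) = f (j - 1) := by
  simp only [← sub_eq_iff_eq_add, Finset.sum_ite_eq, Finset.mem_univ, if_true]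

theorem netCurrent_p {n : ℕ} [NeZero n] (φ : Vertex n → ℝ) (j : ZMod n) :
    (chain n).netCurrent φ (p j) =
      3 * φ (p j) - φ (u j) - φ (u (j - 1)) - φ (q j) := by
  rw [netCurrent_chain]
  simp only [p, u, q, v, Prod.mk.injEq, true_and, reduceCtorEq, false_and, if_false, add_zero,
    zero_add, Finset.sum_add_distrib, Finset.sum_ite_eq, Finset.mem_univ, if_true,
    sum_ite_eq_add_one, sub_add_cancel]
  ring

theorem netCurrent_q {n : ℕ} [NeZero n] (φ : Vertex n → ℝ) (j : ZMod n) :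
    (chain n).netCurrent φ (q j) =
      3 * φ (q j) - φ (v j) - φ (v (j - 1)) - φ (p j) := by
  rw [netCurrent_chain]
  simp only [p, u, q, v, Prod.mk.injEq, true_and, reduceCtorEq, false_and, if_false, add_zero,
    zero_add, Finset.sum_add_distrib, Finset.sum_ite_eq, Finset.mem_univ, if_true,
    sum_ite_eq_add_one, sub_add_cancel]
  ring

theorem netCurrent_u {n : ℕ} [NeZero n] (φ : Vertex n → ℝ) (j : ZMod n) :
    (chain n).netCurrent φ (u j) = 2 * φ (u j) - φ (p j) - φ (p (j + 1)) := by
  rw [netCurrent_chain]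
  simp only [p, u, q, v, Prod.mk.injEq, true_and, reduceCtorEq, false_and, if_false, add_zero,
    zero_add, Finset.sum_add_distrib, Finset.sum_ite_eq, Finset.mem_univ, if_true]
  ring

theorem netCurrent_v {n : ℕ} [NeZero n] (φ : Vertex n → ℝ) (j : ZMod n) :
    (chain n).netCurrent φ (v j) = 2 * φ (v j) - φ (q j) - φ (q (j + 1)) := by
  rw [netCurrent_chain]
  simp only [p, u, q, v, Prod.mk.injEq, true_and, reduceCtorEq, false_and, if_false, add_zero,
    zero_add, Finset.sum_add_distrib, Finset.sum_ite_eq, Finset.mem_univ, if_true]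
  ring

/-! ### The constant `α` -/

theorem sqrt_two_sq : √2 ^ 2 = (2 : ℝ) := Real.sq_sqrt (by norm_num)

theorem α_pos : 0 < α := by
  have h := sqrt_two_sq
  have h0 := Real.sqrt_nonneg (2 : ℝ)
  unfold α
  nlinarith

theorem α_lt_one : α < 1 := by
  have h := sqrt_two_sq
  have h0 := Real.sqrt_nonneg (2 : ℝ)
  unfold α
  nlinarith

theorem α_sq : α ^ 2 = 6 * α - 1 := by
  unfold α
  linear_combination 4 * sqrt_two_sq

theorem one_sub_α_pow_ne_zero {n : ℕ} [NeZero n] : 1 - α ^ n ≠ 0 :=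
  (sub_pos.2 (pow_lt_one₀ α_pos.le α_lt_one (NeZero.ne n))).ne'

/-! ### Green functions of the even and odd parts -/

/-- The Green function of the cycle `ZMod n` with the source at `0`, up to an additive constant. The
formula takes the same value at `0` and at `n`, so it descends from `[0, n]` to `ZMod n`. -/
noncomputable def evenGreen {n : ℕ} (d : ZMod n) : ℝ :=
  -(d.val * (n - d.val)) / (2 * n)

/-- The Green function of the operator `6 f j - f (j + 1) - f (j - 1)` on `ZMod n` with the source
at `0`. As for `evenGreen`, the formula takes the same value at `0` and at `n`. -/
noncomputable def oddGreen {n : ℕ} (d : ZMod n) : ℝ :=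
  (α ^ d.val + α ^ (n - d.val)) / (4 * √2 * (1 - α ^ n))

theorem evenGreen_natCast {n : ℕ} [NeZero n] {k : ℕ} (hk : k ≤ n) :
    evenGreen (k : ZMod n) = -(k * (n - k)) / (2 * n) := by
  rcases hk.lt_or_eq with h | rfl
  · rw [evenGreen, ZMod.val_cast_of_lt h]
  · simp [evenGreen]

theorem oddGreen_natCast {n : ℕ} [NeZero n] {k : ℕ} (hk : k ≤ n) :
    oddGreen (k : ZMod n) = (α ^ k + α ^ (n - k)) / (4 * √2 * (1 - α ^ n)) := by
  rcases hk.lt_or_eq with h | rfl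
  · rw [oddGreen, ZMod.val_cast_of_lt h]
  · simp [oddGreen, add_comm]

/-- Every residue is a natural number below `n`. -/
theorem exists_natCast_eq {n : ℕ} [NeZero n] (d : ZMod n) : ∃ k < n, (k : ZMod n) = d :=
  ⟨d.val, d.val_lt, ZMod.natCast_zmod_val d⟩

theorem neg_natCast {n : ℕ} {k : ℕ} (hk : k ≤ n) : -(k : ZMod n) = ((n - k : ℕ) : ZMod n) := by
  simp [Nat.cast_sub hk]

theorem evenGreen_neg {n : ℕ} [NeZero n] (d : ZMod n) : evenGreen (-d) = evenGreen d := by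
  obtain ⟨k, hk, rfl⟩ := exists_natCast_eq d
  rw [neg_natCast hk.le, evenGreen_natCast hk.le, evenGreen_natCast (Nat.sub_le _ _),
    Nat.cast_sub hk.le]
  ring

theorem oddGreen_neg {n : ℕ} [NeZero n] (d : ZMod n) : oddGreen (-d) = oddGreen d := by
  obtain ⟨k, hk, rfl⟩ := exists_natCast_eq d
  rw [neg_natCast hk.le, oddGreen_natCast hk.le, oddGreen_natCast (Nat.sub_le _ _),
    Nat.sub_sub_self hk.le, add_comm]

theorem evenGreen_laplacian {n : ℕ} [NeZero n] (d : ZMod n) :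
    2 * evenGreen d - evenGreen (d + 1) - evenGreen (d - 1) = (if d = 0 then 1 else 0) - 1 / n := by
  have hn : (n : ℝ) ≠ 0 := NeZero.ne _
  by_cases hd : d = 0
  · subst hd
    have h1 : (1 : ZMod n) = ((1 : ℕ) : ZMod n) := Nat.cast_one.symm
    -- The two neighbours of the source are exchanged by `d ↦ -d`.
    rw [zero_sub, evenGreen_neg, zero_add, h1, evenGreen_natCast NeZero.one_le]
    simp only [evenGreen, ZMod.val_zero, if_true]
    field_simp
    push_cast
    ring
  · obtain ⟨k, hk, rfl⟩ := exists_natCast_eq d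
    obtain _ | k := k
    · simp at hd
    · have h1 : ((k + 1 : ℕ) : ZMod n) + 1 = ((k + 2 : ℕ) : ZMod n) := by push_cast; ring
      have h2 : ((k + 1 : ℕ) : ZMod n) - 1 = (k : ZMod n) := by push_cast; ring
      rw [if_neg hd, h1, h2, evenGreen_natCast hk.le, evenGreen_natCast (by omega),
        evenGreen_natCast (by omega)]
      field_simp
      push_cast
      ring

theorem oddGreen_laplacian {n : ℕ} [NeZero n] (d : ZMod n) :
    6 * oddGreen d - oddGreen (d + 1) - oddGreen (d - 1) = if d = 0 then 1 else 0 := by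
  have hD : 1 - α ^ n ≠ 0 := one_sub_α_pow_ne_zero
  have h2 : √(2 : ℝ) ≠ 0 := by positivity
  by_cases hd : d = 0
  · subst hd
    have h1 : (1 : ZMod n) = ((1 : ℕ) : ZMod n) := Nat.cast_one.symm
    rw [zero_sub, oddGreen_neg, zero_add, h1, oddGreen_natCast NeZero.one_le]
    simp only [oddGreen, ZMod.val_zero, if_true]
    obtain ⟨m, hm⟩ : ∃ m, n = m + 1 := Nat.exists_eq_succ_of_ne_zero (NeZero.ne n)
    have e1 : n - 1 = m := by omega
    rw [e1, Nat.sub_zero]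
    have e2 : α ^ n = α ^ m * α := by rw [hm, pow_succ]
    rw [e2] at hD ⊢
    field_simp
    unfold α
    linear_combination (-8 * (3 - 2 * √2) ^ m) * sqrt_two_sq
  · obtain ⟨k, hk, rfl⟩ := exists_natCast_eq d
    obtain _ | k := k
    · simp at hd
    · have h1 : ((k + 1 : ℕ) : ZMod n) + 1 = ((k + 2 : ℕ) : ZMod n) := by push_cast; ring
      have h2 : ((k + 1 : ℕ) : ZMod n) - 1 = (k : ZMod n) := by push_cast; ring
      obtain ⟨m, hm⟩ : ∃ m, n = k + 2 + m := Nat.exists_eq_add_of_le hk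
      have e0 : n - k = m + 2 := by omega
      have e1 : n - (k + 1) = m + 1 := by omega
      have e2 : n - (k + 2) = m := by omega
      rw [if_neg hd, h1, h2, oddGreen_natCast hk.le, oddGreen_natCast (by omega),
        oddGreen_natCast (by omega), e0, e1, e2]
      linear_combination (-(α ^ k + α ^ m) / (4 * √2 * (1 - α ^ n))) * α_sq

/-- The even part halfway between two neighbouring indices. The correction `1 / (8 n)` accounts for
the drain at the vertices `u` and `v`. -/
noncomputable def evenMid {n : ℕ} (d : ZMod n) : ℝ :=
  (evenGreen d + evenGreen (d + 1)) / 2 - 1 / (8 * n)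

/-- The odd part halfway between two neighbouring indices. -/
noncomputable def oddMid {n : ℕ} (d : ZMod n) : ℝ :=
  (oddGreen d + oddGreen (d + 1)) / 2

/-! ### The Green function of the chain -/

/-- `green a b` is the potential at `b` when a unit current enters at `a` and `1 / (4 n)` leaves at
every vertex. It is the sum of an even and an odd part, the sign of the latter telling whether
`a` and `b` lie on the same side of the cylinder. -/
noncomputable def green {n : ℕ} : Vertex n → Vertex n → ℝ
  | (Site.p, k), (Site.p, j) => evenGreen (j - k) + oddGreen (j - k)
  | (Site.p, k), (Site.q, j) => evenGreen (j - k) - oddGreen (j - k)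
  | (Site.p, k), (Site.u, j) => evenMid (j - k) + oddMid (j - k)
  | (Site.p, k), (Site.v, j) => evenMid (j - k) - oddMid (j - k)
  | (Site.q, k), (Site.q, j) => evenGreen (j - k) + oddGreen (j - k)
  | (Site.q, k), (Site.p, j) => evenGreen (j - k) - oddGreen (j - k)
  | (Site.q, k), (Site.v, j) => evenMid (j - k) + oddMid (j - k)
  | (Site.q, k), (Site.u, j) => evenMid (j - k) - oddMid (j - k)
  | (Site.u, k), (Site.u, j) => evenGreen (j - k) + 2 * oddGreen (j - k)
  | (Site.u, k), (Site.v, j) => evenGreen (j - k) - 2 * oddGreen (j - k)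
  | (Site.u, k), (Site.p, j) => evenMid (j - k - 1) + oddMid (j - k - 1)
  | (Site.u, k), (Site.q, j) => evenMid (j - k - 1) - oddMid (j - k - 1)
  | (Site.v, k), (Site.v, j) => evenGreen (j - k) + 2 * oddGreen (j - k)
  | (Site.v, k), (Site.u, j) => evenGreen (j - k) - 2 * oddGreen (j - k)
  | (Site.v, k), (Site.q, j) => evenMid (j - k - 1) + oddMid (j - k - 1)
  | (Site.v, k), (Site.p, j) => evenMid (j - k - 1) - oddMid (j - k - 1)

theorem netCurrent_green {n : ℕ} [NeZero n] (a x : Vertex n) :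
    (chain n).netCurrent (green a) x = (if x = a then 1 else 0) - 1 / (4 * n) := by
  obtain ⟨s, k⟩ := a
  obtain ⟨t, j⟩ := x
  have hE := evenGreen_laplacian (j - k)
  have hO := oddGreen_laplacian (j - k)
  have h1 : j - 1 - k = j - k - 1 := by ring
  have h2 : j + 1 - k = j - k + 1 := by ring
  have hn : (1 : ℝ) / (8 * n) = 1 / n / 8 := by ring
  have hn' : (1 : ℝ) / (4 * n) = 1 / n / 4 := by ring
  rw [hn']
  cases t
  · rw [← p, netCurrent_p]
    cases s <;> simp only [p, q, u, green, evenMid, oddMid, Prod.mk.injEq, true_and,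
      reduceCtorEq, false_and, if_false, ← sub_eq_zero (a := j) (b := k), h1, sub_add_cancel, hn]
    · linear_combination hE / 2 + hO / 2
    · ring
    · linear_combination hE / 2 - hO / 2
    · ring
  · rw [← u, netCurrent_u]
    cases s <;> simp only [u, p, green, evenMid, oddMid, Prod.mk.injEq, true_and,
      reduceCtorEq, false_and, if_false, ← sub_eq_zero (a := j) (b := k), h2, sub_add_cancel,
      add_sub_cancel_right, hn]
    · ring
    · linear_combination hE / 2 + hO / 2
    · ring
    · linear_combination hE / 2 - hO / 2
  · rw [← q, netCurrent_q]
    cases s <;> simp only [q, p, v, green, evenMid, oddMid, Prod.mk.injEq, true_and,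
      reduceCtorEq, false_and, if_false, ← sub_eq_zero (a := j) (b := k), h1, sub_add_cancel, hn]
    · linear_combination hE / 2 - hO / 2
    · ring
    · linear_combination hE / 2 + hO / 2
    · ring
  · rw [← v, netCurrent_v]
    cases s <;> simp only [v, q, green, evenMid, oddMid, Prod.mk.injEq, true_and,
      reduceCtorEq, false_and, if_false, ← sub_eq_zero (a := j) (b := k), h2, sub_add_cancel,
      add_sub_cancel_right, hn]
    · ring
    · linear_combination hE / 2 - hO / 2
    · ring
    · linear_combination hE / 2 + hO / 2

/-- The drains of the two Green functions cancel in their difference. -/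
theorem r_eq_green {n : ℕ} [NeZero n] (a b : Vertex n) :
    r a b = green a a - green a b - green b a + green b b := by
  have h : (chain n).IsUnitCurrentPotential a b (green a - green b) := by
    intro x
    rw [Graph.netCurrent_sub, netCurrent_green, netCurrent_green]
    simp only [sub_sub_sub_cancel_right]
    congr
  rw [r, Graph.effectiveResistance_eq _ h, Pi.sub_apply, Pi.sub_apply]
  ring

theorem r_comm {n : ℕ} [NeZero n] (a b : Vertex n) : r a b = r b a := by
  rw [r_eq_green, r_eq_green]
  ring

/-! ### Resistances in terms of the index difference -/

theorem evenGreen_sub_comm {n : ℕ} [NeZero n] (k j : ZMod n) :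
    evenGreen (k - j) = evenGreen (j - k) := by
  rw [← neg_sub, evenGreen_neg]

theorem oddGreen_sub_comm {n : ℕ} [NeZero n] (k j : ZMod n) :
    oddGreen (k - j) = oddGreen (j - k) := by
  rw [← neg_sub, oddGreen_neg]

/-- The two half-steps at distance `d + 1 / 2` from `0` are exchanged by negation. -/
theorem evenMid_reflect {n : ℕ} [NeZero n] (k j : ZMod n) :
    evenMid (k - j - 1) = evenMid (j - k) := by
  have h : k - j - 1 = -(j - k + 1) := by ring
  rw [evenMid, evenMid, sub_add_cancel, h, evenGreen_neg, evenGreen_sub_comm k j]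
  ring

theorem oddMid_reflect {n : ℕ} [NeZero n] (k j : ZMod n) :
    oddMid (k - j - 1) = oddMid (j - k) := by
  have h : k - j - 1 = -(j - k + 1) := by ring
  rw [oddMid, oddMid, sub_add_cancel, h, oddGreen_neg, oddGreen_sub_comm k j]
  ring

theorem evenGreen_zero {n : ℕ} : evenGreen (0 : ZMod n) = 0 := by
  simp [evenGreen]

theorem r_p_p {n : ℕ} [NeZero n] (k j : ZMod n) :
    r (p k) (p j) = 2 * (oddGreen (0 : ZMod n) - evenGreen (j - k) - oddGreen (j - k)) := by
  simp only [r_eq_green, p, green, sub_self, evenGreen_zero, evenGreen_sub_comm k j,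
    oddGreen_sub_comm k j]
  ring

theorem r_q_q {n : ℕ} [NeZero n] (k j : ZMod n) :
    r (q k) (q j) = 2 * (oddGreen (0 : ZMod n) - evenGreen (j - k) - oddGreen (j - k)) := by
  simp only [r_eq_green, q, green, sub_self, evenGreen_zero, evenGreen_sub_comm k j,
    oddGreen_sub_comm k j]
  ring

theorem r_p_q {n : ℕ} [NeZero n] (k j : ZMod n) :
    r (p k) (q j) = 2 * (oddGreen (0 : ZMod n) - evenGreen (j - k) + oddGreen (j - k)) := by
  simp only [r_eq_green, p, q, green, sub_self, evenGreen_zero, evenGreen_sub_comm k j,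
    oddGreen_sub_comm k j]
  ring

theorem r_q_p {n : ℕ} [NeZero n] (k j : ZMod n) :
    r (q k) (p j) = 2 * (oddGreen (0 : ZMod n) - evenGreen (j - k) + oddGreen (j - k)) := by
  simp only [r_eq_green, p, q, green, sub_self, evenGreen_zero, evenGreen_sub_comm k j,
    oddGreen_sub_comm k j]
  ring

theorem r_u_u {n : ℕ} [NeZero n] (k j : ZMod n) :
    r (u k) (u j) = 2 * (2 * oddGreen (0 : ZMod n) - evenGreen (j - k) - 2 * oddGreen (j - k)) := by
  simp only [r_eq_green, u, green, sub_self, evenGreen_zero, evenGreen_sub_comm k j,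
    oddGreen_sub_comm k j]
  ring

theorem r_v_v {n : ℕ} [NeZero n] (k j : ZMod n) :
    r (v k) (v j) = 2 * (2 * oddGreen (0 : ZMod n) - evenGreen (j - k) - 2 * oddGreen (j - k)) := by
  simp only [r_eq_green, v, green, sub_self, evenGreen_zero, evenGreen_sub_comm k j,
    oddGreen_sub_comm k j]
  ring

theorem r_u_v {n : ℕ} [NeZero n] (k j : ZMod n) :
    r (u k) (v j) = 2 * (2 * oddGreen (0 : ZMod n) - evenGreen (j - k) + 2 * oddGreen (j - k)) := by
  simp only [r_eq_green, u, v, green, sub_self, evenGreen_zero, evenGreen_sub_comm k j,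
    oddGreen_sub_comm k j]
  ring

theorem r_v_u {n : ℕ} [NeZero n] (k j : ZMod n) :
    r (v k) (u j) = 2 * (2 * oddGreen (0 : ZMod n) - evenGreen (j - k) + 2 * oddGreen (j - k)) := by
  simp only [r_eq_green, u, v, green, sub_self, evenGreen_zero, evenGreen_sub_comm k j,
    oddGreen_sub_comm k j]
  ring

theorem r_p_u {n : ℕ} [NeZero n] (k j : ZMod n) :
    r (p k) (u j) = 3 * oddGreen (0 : ZMod n) - 2 * evenMid (j - k) - 2 * oddMid (j - k) := by
  simp only [r_eq_green, p, u, green, sub_self, evenGreen_zero, evenMid_reflect k j, oddMid_reflect k j]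
  ring

theorem r_q_v {n : ℕ} [NeZero n] (k j : ZMod n) :
    r (q k) (v j) = 3 * oddGreen (0 : ZMod n) - 2 * evenMid (j - k) - 2 * oddMid (j - k) := by
  simp only [r_eq_green, q, v, green, sub_self, evenGreen_zero, evenMid_reflect k j, oddMid_reflect k j]
  ring

theorem r_p_v {n : ℕ} [NeZero n] (k j : ZMod n) :
    r (p k) (v j) = 3 * oddGreen (0 : ZMod n) - 2 * evenMid (j - k) + 2 * oddMid (j - k) := by
  simp only [r_eq_green, p, v, green, sub_self, evenGreen_zero, evenMid_reflect k j, oddMid_reflect k j]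
  ring

theorem r_q_u {n : ℕ} [NeZero n] (k j : ZMod n) :
    r (q k) (u j) = 3 * oddGreen (0 : ZMod n) - 2 * evenMid (j - k) + 2 * oddMid (j - k) := by
  simp only [r_eq_green, q, u, green, sub_self, evenGreen_zero, evenMid_reflect k j, oddMid_reflect k j]
  ring

/-! ### Closed forms -/

theorem evenMid_natCast {n : ℕ} [NeZero n] {m : ℕ} (hm : m < n) :
    evenMid (m : ZMod n) = (2 * (m : ℝ) + 1) ^ 2 / (8 * n) - (2 * m + 1) / 4 := by
  have hn : (n : ℝ) ≠ 0 := NeZero.ne _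
  have h : (m : ZMod n) + 1 = ((m + 1 : ℕ) : ZMod n) := by push_cast; rfl
  rw [evenMid, h, evenGreen_natCast hm.le, evenGreen_natCast (by omega)]
  field_simp
  push_cast
  ring

end HexCylinder

open HexCylinder in
theorem mainTheorem2 (n : ℕ) [NeZero n] :
    (∀ i : ℕ, 1 ≤ i → i ≤ n →
      r (p (1 : ZMod n)) (p (i : ZMod n)) =
        (1 + α ^ n - α ^ ((n : ℤ) - i + 1) - α ^ ((i : ℤ) - 1)) / (2 * √2 * (1 - α ^ n))
          + ((n : ℝ) - i + 1) * ((i : ℝ) - 1) / n ∧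
      r (p (1 : ZMod n)) (q (i : ZMod n)) =
        (1 + α ^ n + α ^ ((n : ℤ) - i + 1) + α ^ ((i : ℤ) - 1)) / (2 * √2 * (1 - α ^ n))
          + ((n : ℝ) - i + 1) * ((i : ℝ) - 1) / n ∧
      r (u (1 : ZMod n)) (u (i : ZMod n)) =
        (1 + α ^ n - α ^ ((n : ℤ) - i + 1) - α ^ ((i : ℤ) - 1)) / (√2 * (1 - α ^ n))
          + ((n : ℝ) - i + 1) * ((i : ℝ) - 1) / n ∧
      r (u (1 : ZMod n)) (v (i : ZMod n)) =
        (1 + α ^ n + α ^ ((n : ℤ) - i + 1) + α ^ ((i : ℤ) - 1)) / (√2 * (1 - α ^ n))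
          + ((n : ℝ) - i + 1) * ((i : ℝ) - 1) / n ∧
      r (p (1 : ZMod n)) (u (i : ZMod n)) =
        (11 + 2 * √2 - (20 + 14 * √2) * α ^ ((i : ℤ) + 1)
            - (20 - 14 * √2) * α ^ ((n : ℤ) - i - 1) - (5 + 2 * √2) * α ^ n)
            / (4 * √2 * (1 - α ^ n))
          - (2 * (i : ℝ) - 1) ^ 2 / (4 * n) + i - 1 - √2 ∧
      r (p (1 : ZMod n)) (v (i : ZMod n)) =
        (11 + 2 * √2 + (20 + 14 * √2) * α ^ ((i : ℤ) + 1)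
            + (20 - 14 * √2) * α ^ ((n : ℤ) - i - 1) - (5 + 2 * √2) * α ^ n)
            / (4 * √2 * (1 - α ^ n))
          - (2 * (i : ℝ) - 1) ^ 2 / (4 * n) + i - 1 - √2) ∧
    (∀ k j i : ℕ, 1 ≤ k → k ≤ n → 1 ≤ j → j ≤ n → 1 ≤ i → i ≤ n →
      (i : ℤ) ≡ (j : ℤ) - k + 1 [ZMOD n] →
      (r (p (k : ZMod n)) (p (j : ZMod n)) = r (p (1 : ZMod n)) (p (i : ZMod n)) ∧
        r (q (k : ZMod n)) (q (j : ZMod n)) = r (p (1 : ZMod n)) (p (i : ZMod n))) ∧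
      (r (p (k : ZMod n)) (q (j : ZMod n)) = r (p (1 : ZMod n)) (q (i : ZMod n)) ∧
        r (q (k : ZMod n)) (p (j : ZMod n)) = r (p (1 : ZMod n)) (q (i : ZMod n))) ∧
      (r (u (k : ZMod n)) (u (j : ZMod n)) = r (u (1 : ZMod n)) (u (i : ZMod n)) ∧
        r (v (k : ZMod n)) (v (j : ZMod n)) = r (u (1 : ZMod n)) (u (i : ZMod n))) ∧
      (r (u (k : ZMod n)) (v (j : ZMod n)) = r (u (1 : ZMod n)) (v (i : ZMod n)) ∧
        r (v (k : ZMod n)) (u (j : ZMod n)) = r (u (1 : ZMod n)) (v (i : ZMod n))) ∧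
      (r (p (k : ZMod n)) (u (j : ZMod n)) = r (p (1 : ZMod n)) (u (i : ZMod n)) ∧
        r (q (k : ZMod n)) (v (j : ZMod n)) = r (p (1 : ZMod n)) (u (i : ZMod n))) ∧
      (r (p (k : ZMod n)) (v (j : ZMod n)) = r (p (1 : ZMod n)) (v (i : ZMod n)) ∧
        r (q (k : ZMod n)) (u (j : ZMod n)) = r (p (1 : ZMod n)) (v (i : ZMod n)))) ∧
    (∀ x y : Vertex n, r x y = r y x) := by
  refine ⟨fun i hi hin => ?_, fun k j i _ _ _ _ _ _ hijk => ?_, r_comm⟩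
  · obtain ⟨m, rfl⟩ : ∃ m, i = m + 1 := ⟨i - 1, by omega⟩
    obtain ⟨s, hs⟩ : ∃ s, n = m + 1 + s := Nat.exists_eq_add_of_le hin
    have hn : (n : ℝ) ≠ 0 := NeZero.ne _
    have hD : 1 - α ^ n ≠ 0 := one_sub_α_pow_ne_zero
    have h2 : √(2 : ℝ) ≠ 0 := by positivity
    have hd : ((m + 1 : ℕ) : ZMod n) - 1 = (m : ZMod n) := by push_cast; ring
    have hE := evenGreen_natCast (n := n) (k := m) (by omega)
    have hB := oddGreen_natCast (n := n) (k := m) (by omega)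
    have hB0 := oddGreen_natCast (n := n) (k := 0) (by omega)
    have hB1 := oddGreen_natCast (n := n) (k := m + 1) hin
    have hM := evenMid_natCast (n := n) (m := m) (by omega)
    have hC : oddMid (m : ZMod n) =
        (oddGreen (m : ZMod n) + oddGreen ((m + 1 : ℕ) : ZMod n)) / 2 := by
      rw [oddMid, Nat.cast_add, Nat.cast_one]
    rw [hB, hB1] at hC
    have e1 : n - m = s + 1 := by omega
    have e2 : n - (m + 1) = s := by omega
    have e3 : (n : ℤ) - (m + 1 : ℕ) + 1 = (s + 1 : ℕ) := by omega
    have e4 : ((m + 1 : ℕ) : ℤ) - 1 = (m : ℕ) := by omega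
    have e5 : ((m + 1 : ℕ) : ℤ) + 1 = (m + 2 : ℕ) := by omega
    have e6 : (n : ℤ) - (m + 1 : ℕ) - 1 = (s : ℤ) - 1 := by omega
    have hαi : α⁻¹ = 3 + 2 * √2 := by
      refine inv_eq_of_mul_eq_one_right ?_
      unfold α
      linear_combination (-4) * sqrt_two_sq
    rw [e1] at hB
    rw [e1, e2] at hC
    rw [Nat.cast_zero, Nat.sub_zero, pow_zero] at hB0
    rw [e3, e4, e5, e6, zpow_natCast, zpow_natCast, zpow_natCast, zpow_sub_one₀ α_pos.ne', hαi,
      zpow_natCast, r_p_p, r_p_q, r_u_u, r_u_v, r_p_u, r_p_v, hd, hE, hB, hB0, hM, hC]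
    have hα : α = 3 - 2 * √2 := rfl
    have hα2 : α ^ (m + 2) = α ^ m * (17 - 12 * √2) := by
      rw [pow_add, α_sq, hα]; ring
    have hα1 : α ^ (m + 1) = α ^ m * (3 - 2 * √2) := by rw [pow_succ, ← α]
    have hαs : α ^ (s + 1) = α ^ s * (3 - 2 * √2) := by rw [pow_succ, ← α]
    rw [hα2, hα1, hαs]
    -- The identities are now rational in `√2`, `α ^ n`, `α ^ m` and `α ^ s`, and the relation between
    -- these three powers is not needed.
    generalize α ^ n = z at *
    generalize α ^ m = x at *
    generalize α ^ s = y at *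
    have hr := sqrt_two_sq
    generalize √(2 : ℝ) = r at *
    push_cast
    refine ⟨?_, ?_, ?_, ?_, ?_, ?_⟩
    · field_simp
      ring
    · field_simp
      ring
    · field_simp
      ring
    · field_simp
      ring
    -- Over the denominator `4 * r * (1 - z)` the two sides differ by a multiple of `r ^ 2 - 2`.
    · linear_combination (norm := (field_simp; ring))
        (-(168 * x + 28 * y - 4 * (1 - z)) / (4 * r * (1 - z))) * hr
    · linear_combination (norm := (field_simp; ring))
        ((168 * x + 28 * y + 4 * (1 - z)) / (4 * r * (1 - z))) * hr
  · have hi : (i : ZMod n) - 1 = j - k := by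
      have := (ZMod.intCast_eq_intCast_iff _ _ _).2 hijk
      push_cast at this
      rw [this, add_sub_cancel_right]
    simp only [r_p_p, r_q_q, r_p_q, r_q_p, r_u_u, r_v_v, r_u_v, r_v_u, r_p_u, r_q_v, r_p_v, r_q_u,
      hi, and_self]
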